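/- Errors. Let $A$ be a finite alphabet with $q$ symbols, let $x=(x_1,\dots,x_\ell)\in A^\ell$, and suppose that the symbol $x_i$ is read $m_i\ge 0$ times, so that the received word is $x_1^{m_1}x_2^{m_2}\cdots x_\ell^{m_\ell}$. Position $i$ is deleted if $m_i=0$, and it suffers sticky insertions (repetitions) if $m_i\ge 2$. A set of positions is a pattern of at most $t_1$ bursts of length at most $b$ if it is a union of at most $t_1$ intervals of consecutive positions, each of length between $1$ and $b$, any two of which are separated by at least one position outside the set. A code $C\subseteq A^\ell$ is a $q$-ary $b$-limited $t_1$-burst-deletion-correcting code of length $\ell$ if each codeword is uniquely determined by every word that can be received from it when all $m_i\le 1$ and the deleted positions form a pattern of at most $t_1$ bursts of length at most $b$ (that is, two different codewords never lead to the same received word under such errors). It is a $q$-ary $b$-limited $t_1$-burst-deletion sticky-insertion-correcting code if the same holds when the $m_i$ are arbitrary nonnegative integers whose zero positions form such a pattern. The rate of $C$ is $R=\log_q|C|/\ell$. Theorem. Let $0<\delta,\epsilon<1$. There is an integer $Q=Q(\delta,\epsilon)$ such that for all positive integers $b,\ell$, every integer $t_1\ge 0$ with $t_1 b\le\delta\ell$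 (in particular whenever $t_1b=\delta\ell$), and every alphabet of size $q$ the following hold. (1) If $q\ge Q\,(b+1)$, then there is a (nonempty) $q$-ary $b$-limited $t_1$-burst-deletion-correcting code of length $\ell$ whose rate satisfies $$R\ \ge\ (1-\log_q(b+1))\,(1-\delta-\epsilon).$$ (2) If $q\ge Q\,(b+2)$, then there is a (nonempty) $q$-ary $b$-limited $t_1$-burst-deletion sticky-insertion-correcting code of length $\ell$ whose rate satisfies $$R\ \ge\ (1-\log_q(b+2))\,(1-\delta-\epsilon).$$ -/

import Mathlib

/-- The word received when the symbol at position `i` of `x` is read `m i` times: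
`m i = 0` is a deletion, `m i = 1` a correct read, and `m i ≥ 2` means that
`m i - 1` sticky insertions (repetitions) occurred at position `i`. -/
def readWord {A : Type*} {l : ℕ} (m : Fin l → ℕ) (x : Fin l → A) : List A :=
  (List.finRange l).flatMap fun i => List.replicate (m i) (x i)

/-- `D` is the set of positions deleted by at most `t` bursts: it is the union of `k ≤ t`
intervals of consecutive positions (listed from left to right), each of length at least `1`
and at most `b`, any two of them separated by at least one position outside `D`. -/
def IsBurstPattern (b t : ℕ) {l : ℕ} (D : Set (Fin l)) : Prop :=
  ∃ (k : ℕ) (start len : Fin k → ℕ),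
    k ≤ t ∧
    (∀ j, 1 ≤ len j ∧ len j ≤ b ∧ start j + len j ≤ l) ∧
    (∀ i j, i < j → start i + len i < start j) ∧
    ∀ p : Fin l, p ∈ D ↔ ∃ j, start j ≤ (p : ℕ) ∧ (p : ℕ) < start j + len j

/-- `C` is a `b`-limited `t`-burst-deletion-correcting code: a codeword is uniquely determined
by the word received after at most `t` bursts of deletions, each of length at most `b`. -/
def IsBurstDeletionCorrecting {A : Type*} {l : ℕ} (b t : ℕ) (C : Finset (Fin l → A)) : Prop :=
  ∀ x ∈ C, ∀ y ∈ C, ∀ m m' : Fin l → ℕ,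
    (∀ i, m i ≤ 1) → (∀ i, m' i ≤ 1) →
    IsBurstPattern b t {i | m i = 0} → IsBurstPattern b t {i | m' i = 0} →
    readWord m x = readWord m' y → x = y

/-- `C` is a `b`-limited `t`-burst-deletion sticky-insertion-correcting code: a codeword is
uniquely determined by the word received after any number of sticky insertions and at most `t`
bursts of deletions, each of length at most `b`. -/
def IsBurstDeletionStickyCorrecting {A : Type*} {l : ℕ} (b t : ℕ)
    (C : Finset (Fin l → A)) : Prop :=
  ∀ x ∈ C, ∀ y ∈ C, ∀ m m' : Fin l → ℕ,
    IsBurstPattern b t {i | m i = 0} → IsBurstPattern b t {i | m' i = 0} →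
    readWord m x = readWord m' y → x = y

/-- The rate `log_q |C| / l` of a code `C` of length `l` over an alphabet of size `q`. -/
noncomputable def codeRate {A : Type*} [Fintype A] {l : ℕ} (C : Finset (Fin l → A)) : ℝ :=
  Real.logb (Fintype.card A) C.card / l

/-! Split the alphabet as labels modulo `M` times payloads from `Fin r`, with `r = q / M`, and let
position `i` carry the label `i + 1` modulo `M`. A burst removes at most `b` consecutive positions,
so successive received positions differ by 1 to `b + 1`, or by 0 to `b + 1` when repetitions are
allowed. Hence `M = b + 1`, respectively `M = b + 2`, makes the labels determine the positions
(`readPairs_eq_of_readWord_eq`). Deletions thereby become at most `t * b` erasures, which Hamming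
distance above `t * b` corrects (`eq_of_readWord_eq`). A Gilbert–Varshamov code on the payloads has
the required rate up to a constant loss per symbol, absorbed by `ε` once `q / M` is large
(`le_codeRate`). -/

theorem isChain_cons_replicate_append {α : Type*} {R : α → α → Prop} {c : α} {L : List α}
    (hR : R c c) (h : (c :: L).IsChain R) :
    ∀ n, (c :: (List.replicate n c ++ L)).IsChain R
  | 0 => by simpa using h
  | n + 1 => by
    rw [List.replicate_succ, List.cons_append, List.isChain_cons_cons]
    exact ⟨hR, isChain_cons_replicate_append hR h n⟩

/-- A list whose successive differences lie in a window of length `M` is determined by its first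
entry and its reduction modulo `M`. -/
theorem eq_of_isChain_of_map_mod_eq {s M : ℕ} {L L' : List ℕ} {a : ℕ}
    (h : (a :: L).IsChain fun i j => i + s ≤ j ∧ j < i + s + M)
    (h' : (a :: L').IsChain fun i j => i + s ≤ j ∧ j < i + s + M)
    (hmod : L.map (· % M) = L'.map (· % M)) : L = L' := by
  induction L generalizing a L' with
  | nil => cases L' <;> simp_all
  | cons c L ih =>
    cases L' with
    | nil => simp at hmod
    | cons c' L' =>
      rw [List.isChain_cons_cons] at h h'
      simp only [List.map_cons, List.cons.injEq] at hmod
      obtain ⟨⟨h1, h2⟩, h3⟩ := h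
      obtain ⟨⟨h1', h2'⟩, h3'⟩ := h'
      have hc : c = c' := by
        have hm : c ≡ c' [MOD M] := hmod.1
        rcases le_total c c' with hle | hle
        · have := Nat.eq_zero_of_dvd_of_lt ((Nat.modEq_iff_dvd' hle).1 hm) (by omega)
          omega
        · have := Nat.eq_zero_of_dvd_of_lt ((Nat.modEq_iff_dvd' hle).1 hm.symm) (by omega)
          omega
      subst hc
      rw [ih h3 h3' hmod.2]

/-! ### Recovering positions from labels -/

/-- The received word together with the positions of its symbols. -/
def readPairs {A : Type*} {l : ℕ} (m : Fin l → ℕ) (x : Fin l → A) : List (Fin l × A) :=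
  (List.finRange l).flatMap fun i => List.replicate (m i) (i, x i)

theorem map_snd_readPairs {A : Type*} {l : ℕ} (m : Fin l → ℕ) (x : Fin l → A) :
    (readPairs m x).map Prod.snd = readWord m x := by
  simp [readPairs, readWord, List.map_flatMap]

theorem mem_readPairs {A : Type*} {l : ℕ} {m : Fin l → ℕ} {x : Fin l → A} {p : Fin l × A} :
    p ∈ readPairs m x ↔ m p.1 ≠ 0 ∧ p.2 = x p.1 := by
  obtain ⟨i, a⟩ := p
  simp only [readPairs, List.mem_flatMap, List.mem_finRange, true_and, List.mem_replicate,
    Prod.mk.injEq]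
  constructor
  · rintro ⟨j, hj, rfl, rfl⟩
    exact ⟨hj, rfl⟩
  · rintro ⟨hi, rfl⟩
    exact ⟨i, hi, rfl, rfl⟩

/-- A run of consecutive positions inside a burst pattern has length at most `b`. -/
theorem IsBurstPattern.run_le {b t l : ℕ} {D : Set (Fin l)} (hD : IsBurstPattern b t D)
    {u v : ℕ} (hv : v ≤ l) (hrun : ∀ p : Fin l, u ≤ p → (p : ℕ) < v → p ∈ D) : v ≤ u + b := by
  obtain ⟨k, start, len, -, hlen, hsep, hmem⟩ := hD
  by_contra! hlt
  obtain ⟨j, hj1, hj2⟩ := (hmem ⟨u, by omega⟩).1 (hrun ⟨u, by omega⟩ le_rfl (by simp; omega))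
  -- The run cannot leave interval `j`: passing to another interval would cross the gap that
  -- separates them.
  have key : ∀ n, u + n < v → u + n < start j + len j := by
    intro n
    induction n with
    | zero => intro _; simpa using hj2
    | succ n ih =>
      intro hn
      have hp := ih (by omega)
      obtain ⟨j', h1, h2⟩ := (hmem ⟨u + (n + 1), by omega⟩).1
        (hrun ⟨u + (n + 1), by omega⟩ (by simp) (by simpa using hn))
      simp only at hj1 h1 h2
      rcases lt_trichotomy j j' with hjj | rfl | hjj
      · have := hsep _ _ hjj; omega
      · exact h2
      · have := hsep _ _ hjj; omega
  have h1 := key b hlt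
  have h2 := hlen j
  have h3 := key (v - u - 1) (by omega)
  simp only at hj1
  omega

theorem IsBurstPattern.card_le {b t l : ℕ} {D : Set (Fin l)} (hD : IsBurstPattern b t D)
    {S : Finset (Fin l)} (hS : ∀ i ∈ S, i ∈ D) : S.card ≤ t * b := by
  obtain ⟨k, start, len, hk, hlen, -, hmem⟩ := hD
  have hsub : S.map Fin.valEmbedding ⊆
      Finset.univ.biUnion fun j => Finset.Ico (start j) (start j + len j) := by
    intro n hn
    obtain ⟨i, hi, rfl⟩ := Finset.mem_map.1 hn
    obtain ⟨j, h⟩ := (hmem i).1 (hS i hi)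
    simp only [Finset.mem_biUnion, Finset.mem_univ, true_and, Finset.mem_Ico]
    exact ⟨j, h⟩
  calc S.card = (S.map Fin.valEmbedding).card := (Finset.card_map _).symm
    _ ≤ _ := Finset.card_le_card hsub
    _ ≤ (Finset.univ : Finset (Fin k)).card * b :=
        Finset.card_biUnion_le_card_mul _ _ _ fun j _ => by simpa using (hlen j).2.1
    _ ≤ t * b := by simpa using Nat.mul_le_mul_right b hk

/-- Positions count from 1. Here `a` is the last surviving one (0 if none) and `k` the next index to
process; the indices from `a` up to `k` are all deleted, so `run_le` bounds the gap. The shift `s`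
is 1 without repetitions and 0 with them. -/
theorem isChain_flatMap_positions {b t l s M : ℕ} {m : Fin l → ℕ}
    (hD : IsBurstPattern b t {i | m i = 0}) (hs : s ≤ 1) (hM : b + 2 ≤ s + M)
    (hm : s = 0 ∨ ∀ i, m i ≤ 1) :
    ∀ (L : List (Fin l)) (a k : ℕ), L.map Fin.val = List.range' k L.length → a ≤ k →
      (∀ p : Fin l, a ≤ p → (p : ℕ) < k → m p = 0) →
      (a :: L.flatMap fun i => List.replicate (m i) ((i : ℕ) + 1)).IsChain
        fun i j => i + s ≤ j ∧ j < i + s + M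
  | [], a, k, _, _, _ => by simp
  | i :: L, a, k, hL, hak, hrun => by
    rw [List.map_cons, List.length_cons, List.range'_succ, List.cons.injEq] at hL
    obtain ⟨rfl, hL⟩ := hL
    rw [List.flatMap_cons]
    by_cases hi : m i = 0
    · rw [hi, List.replicate_zero, List.nil_append]
      refine isChain_flatMap_positions hD hs hM hm L a (i + 1) hL (by omega) fun p h1 h2 => ?_
      rcases eq_or_ne p i with rfl | hne
      · exact hi
      · exact hrun p h1 (by have := Fin.val_ne_of_ne hne; omega)
    · have ih := isChain_flatMap_positions hD hs hM hm L (i + 1) (i + 1) hL le_rfl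
        fun p h1 h2 => by omega
      have hgap := hD.run_le (u := a) i.2.le hrun
      obtain ⟨n, hn⟩ := Nat.exists_eq_succ_of_ne_zero hi
      rw [hn, List.replicate_succ, List.cons_append, List.isChain_cons_cons]
      refine ⟨by omega, ?_⟩
      rcases hm with rfl | hm
      · exact isChain_cons_replicate_append (by omega) ih n
      · obtain rfl : n = 0 := by have := hm i; omega
        simpa using ih

theorem isChain_positions {A : Type*} {b t l s M : ℕ} {m : Fin l → ℕ} (x : Fin l → A)
    (hD : IsBurstPattern b t {i | m i = 0}) (hs : s ≤ 1) (hM : b + 2 ≤ s + M)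
    (hm : s = 0 ∨ ∀ i, m i ≤ 1) :
    (0 :: (readPairs m x).map fun p => (p.1 : ℕ) + 1).IsChain
      fun i j => i + s ≤ j ∧ j < i + s + M := by
  have h := isChain_flatMap_positions hD hs hM hm (List.finRange l) 0 0
    (by simp [List.range_eq_range']) le_rfl fun p _ h => by omega
  simpa [readPairs, List.map_flatMap] using h

/-- If every symbol records its position modulo `M`, the received word determines the undeleted
positions and their symbols. -/
theorem readPairs_eq_of_readWord_eq {A : Type*} {b t l s M : ℕ} {m m' : Fin l → ℕ}
    {x y : Fin l → A} {lab : A → ℕ} (hs : s ≤ 1) (hM : b + 2 ≤ s + M)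
    (hx : ∀ i, lab (x i) = ((i : ℕ) + 1) % M) (hy : ∀ i, lab (y i) = ((i : ℕ) + 1) % M)
    (hD : IsBurstPattern b t {i | m i = 0}) (hD' : IsBurstPattern b t {i | m' i = 0})
    (hm : s = 0 ∨ (∀ i, m i ≤ 1) ∧ ∀ i, m' i ≤ 1) (hread : readWord m x = readWord m' y) :
    readPairs m x = readPairs m' y := by
  have hlab : ∀ {n : Fin l → ℕ} {z : Fin l → A}, (∀ i, lab (z i) = ((i : ℕ) + 1) % M) →
      ((readPairs n z).map fun p => (p.1 : ℕ) + 1).map (· % M) = (readWord n z).map lab := by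
    intro n z hz
    rw [← map_snd_readPairs, List.map_map, List.map_map]
    refine List.map_congr_left fun p hp => ?_
    simp [(mem_readPairs.1 hp).2, hz]
  have hpos := eq_of_isChain_of_map_mod_eq
    (isChain_positions x hD hs hM (hm.imp id And.left))
    (isChain_positions y hD' hs hM (hm.imp id And.right))
    (by rw [hlab hx, hlab hy, hread])
  rw [← map_snd_readPairs, ← map_snd_readPairs] at hread
  have hlen : (readPairs m x).length = (readPairs m' y).length := by
    simpa using congrArg List.length hread
  refine List.ext_getElem hlen fun n h1 h2 => Prod.ext (Fin.ext ?_) ?_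
  · simpa [h1, h2] using congrArg (fun L => L[n]?) hpos
  · simpa [h1, h2] using congrArg (fun L => L[n]?) hread

/-- A surviving position shows the same symbol in both words, so the words differ only at deleted
positions, of which there are too few. -/
theorem eq_of_readWord_eq {A : Type*} [DecidableEq A] {b t l s M : ℕ} {m m' : Fin l → ℕ}
    {x y : Fin l → A} {lab : A → ℕ} (hs : s ≤ 1) (hM : b + 2 ≤ s + M)
    (hx : ∀ i, lab (x i) = ((i : ℕ) + 1) % M) (hy : ∀ i, lab (y i) = ((i : ℕ) + 1) % M)
    (hD : IsBurstPattern b t {i | m i = 0}) (hD' : IsBurstPattern b t {i | m' i = 0})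
    (hm : s = 0 ∨ (∀ i, m i ≤ 1) ∧ ∀ i, m' i ≤ 1)
    (hdist : x ≠ y → t * b < hammingDist x y) (hread : readWord m x = readWord m' y) :
    x = y := by
  by_contra hne
  refine (hdist hne).not_ge (hD.card_le fun i hi => ?_)
  by_contra h0
  have hmem : (i, x i) ∈ readPairs m x := mem_readPairs.2 ⟨h0, rfl⟩
  rw [readPairs_eq_of_readWord_eq hs hM hx hy hD hD' hm hread, mem_readPairs] at hmem
  exact (Finset.mem_filter.1 hi).2 hmem.2

/-! ### Codes of large Hamming distance -/

/-- Each word of the ball lies in a cube indexed by its set of differing coordinates; all subsets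
are counted crudely by the power of 2. -/
theorem card_filter_hammingDist_le {ι B : Type*} [Fintype ι] [Fintype B] [DecidableEq ι]
    [DecidableEq B] [Nonempty B] (c : ι → B) (d : ℕ) :
    (Finset.univ.filter fun w => hammingDist c w ≤ d).card ≤
      2 ^ Fintype.card ι * Fintype.card B ^ d := by
  let T : Finset (Finset ι) := Finset.univ.filter fun S => S.card ≤ d
  let F : Finset ι → Finset (ι → B) := fun S =>
    Fintype.piFinset fun i => if i ∈ S then Finset.univ else {c i}
  have hsub : (Finset.univ.filter fun w => hammingDist c w ≤ d) ⊆ T.biUnion F := by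
    intro w hw
    refine Finset.mem_biUnion.2 ⟨Finset.univ.filter fun i => c i ≠ w i, ?_, ?_⟩
    · simpa [T, hammingDist] using hw
    · refine Fintype.mem_piFinset.2 fun i => ?_
      by_cases h : c i = w i <;> simp [h]
  have hF : ∀ S ∈ T, (F S).card ≤ Fintype.card B ^ d := by
    intro S hS
    have : (F S).card = Fintype.card B ^ S.card := by
      simp only [F, Fintype.card_piFinset, apply_ite Finset.card, Finset.card_univ,
        Finset.card_singleton]
      simp
    rw [this]
    exact Nat.pow_le_pow_right Fintype.card_pos (by simpa [T] using hS)
  calc _ ≤ _ := Finset.card_le_card hsub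
    _ ≤ T.card * Fintype.card B ^ d := Finset.card_biUnion_le_card_mul _ _ _ hF
    _ ≤ _ := Nat.mul_le_mul_right _ (by simpa using Finset.card_le_univ T)

/-- A weak form of the Gilbert–Varshamov bound. -/
theorem exists_code_hammingDist_gt (ι B : Type*) [Fintype ι] [Fintype B] [DecidableEq ι]
    [DecidableEq B] [Nonempty B] (d : ℕ) :
    ∃ C : Finset (ι → B), (∀ x ∈ C, ∀ y ∈ C, x ≠ y → d < hammingDist x y) ∧
      Fintype.card B ^ Fintype.card ι ≤
        C.card * (2 ^ Fintype.card ι * Fintype.card B ^ d) := by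
  let P : Finset (ι → B) → Prop := fun C => ∀ x ∈ C, ∀ y ∈ C, x ≠ y → d < hammingDist x y
  obtain ⟨C, hC⟩ := (Set.toFinite {C | P C}).exists_maximal ⟨∅, by simp [P]⟩
  refine ⟨C, hC.prop, ?_⟩
  have hcover : (Finset.univ : Finset (ι → B)) ⊆
      C.biUnion fun c => Finset.univ.filter fun w => hammingDist c w ≤ d := by
    intro w _
    by_contra hw
    simp only [Finset.mem_biUnion, Finset.mem_filter, Finset.mem_univ, true_and, not_exists,
      not_and, not_le] at hw
    have hP : P (insert w C) := by
      intro x hx y hy hxy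
      rcases Finset.mem_insert.1 hx with hx' | hx' <;>
        rcases Finset.mem_insert.1 hy with hy' | hy'
      · exact absurd (hx'.trans hy'.symm) hxy
      · rw [hx', hammingDist_comm]; exact hw y hy'
      · rw [hy']; exact hw x hx'
      · exact hC.prop x hx' y hy' hxy
    have hmem : w ∈ C := hC.le_of_ge hP (Finset.subset_insert w C) (Finset.mem_insert_self w C)
    simpa using hw w hmem
  calc _ = (Finset.univ : Finset (ι → B)).card := by simp
    _ ≤ _ := Finset.card_le_card hcover
    _ ≤ _ := Finset.card_biUnion_le_card_mul _ _ _ fun c _ => card_filter_hammingDist_le c d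

/-- A code of large Hamming distance whose symbols record their positions modulo `M`. -/
theorem exists_labelled_code {A : Type*} [Fintype A] [DecidableEq A] {l M r : ℕ} (d : ℕ)
    (hM : 0 < M) (hr0 : 0 < r) (hr : M * r ≤ Fintype.card A) :
    ∃ (C : Finset (Fin l → A)) (lab : A → ℕ),
      (∀ x ∈ C, ∀ i, lab (x i) = ((i : ℕ) + 1) % M) ∧
      (∀ x ∈ C, ∀ y ∈ C, x ≠ y → d < hammingDist x y) ∧
      r ^ l ≤ C.card * (2 ^ l * r ^ d) := by
  have : NeZero r := ⟨hr0.ne'⟩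
  obtain ⟨e⟩ : Nonempty (Fin M × Fin r ↪ A) :=
    Function.Embedding.nonempty_of_card_le (by simpa using hr)
  obtain ⟨C, hC, hcard⟩ := exists_code_hammingDist_gt (Fin l) (Fin r) d
  let f : Fin l → Fin r → A := fun i a => e (⟨((i : ℕ) + 1) % M, Nat.mod_lt _ hM⟩, a)
  have hf : ∀ i, Function.Injective (f i) := fun i a a' h => by
    simpa [f] using h
  let g : (Fin l → Fin r) ↪ (Fin l → A) :=
    ⟨fun w i => f i (w i), fun w w' h => funext fun i => hf i (congrFun h i)⟩
  have hinv : ∃ lab : A → ℕ, ∀ p, lab (e p) = p.1 :=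
    ⟨Function.extend e (fun p => (p.1 : ℕ)) 0, fun p => e.injective.extend_apply _ _ p⟩
  obtain ⟨lab, hlab⟩ := hinv
  refine ⟨C.map g, lab, ?_, ?_, by simpa using hcard⟩
  · intro x hx i
    obtain ⟨w, -, rfl⟩ := Finset.mem_map.1 hx
    exact hlab _
  · intro x hx y hy hxy
    obtain ⟨w, hw, rfl⟩ := Finset.mem_map.1 hx
    obtain ⟨w', hw', rfl⟩ := Finset.mem_map.1 hy
    have := hC w hw w' hw' fun h => hxy (h ▸ rfl)
    rwa [← hammingDist_comp f hf] at this

/-! ### Rate estimate -/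

theorem le_codeRate {A : Type*} [Fintype A] {l M r d : ℕ} {δ ε : ℝ} {C : Finset (Fin l → A)}
    (hδ1 : δ < 1) (hδ0 : 0 < δ) (hl : 0 < l) (hM : 0 < M) (hd : (d : ℝ) ≤ δ * l) (hr : 0 < r)
    (hcard : 1 < Fintype.card A) (hrA : (Fintype.card A : ℝ) ≤ 2 * (M * r))
    (hε : 2 * Real.log 2 ≤ ε * (Real.log (Fintype.card A) - Real.log M))
    (hC : r ^ l ≤ C.card * (2 ^ l * r ^ d)) :
    (1 - Real.logb (Fintype.card A) M) * (1 - δ - ε) ≤ codeRate C := by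
  set q := Fintype.card A with hq
  have hC0 : 0 < C.card := Nat.pos_of_ne_zero fun h => by
    rw [h, zero_mul] at hC
    exact hC.not_gt (pow_pos hr l)
  have hr' : (0 : ℝ) < r := by exact_mod_cast hr
  have hM' : (0 : ℝ) < M := by exact_mod_cast hM
  have hl' : (0 : ℝ) < l := by exact_mod_cast hl
  have hq' : (1 : ℝ) < q := by exact_mod_cast hcard
  have hC' : (0 : ℝ) < C.card := by exact_mod_cast hC0
  have hlogq : 0 < Real.log q := Real.log_pos hq'
  have hlogr : 0 ≤ Real.log r := Real.log_natCast_nonneg r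
  have h1 : l * Real.log r ≤ Real.log C.card + (l * Real.log 2 + d * Real.log r) := by
    have h : (r : ℝ) ^ l ≤ C.card * (2 ^ l * r ^ d) := by exact_mod_cast hC
    have := Real.log_le_log (by positivity) h
    rwa [Real.log_mul (by positivity) (by positivity), Real.log_mul (by positivity)
      (by positivity), Real.log_pow, Real.log_pow, Real.log_pow] at this
  have h2 : Real.log q - Real.log M ≤ Real.log 2 + Real.log r := by
    have := Real.log_le_log (by positivity) hrA
    rw [Real.log_mul (by positivity) (by positivity), Real.log_mul (by positivity)
      (by positivity)] at this
    linarith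
  have h3 := mul_le_mul_of_nonneg_right hd hlogr
  have h4 := mul_le_mul_of_nonneg_left h2 (mul_nonneg (sub_nonneg.2 hδ1.le) hl'.le)
  have h5 := mul_le_mul_of_nonneg_left hε hl'.le
  have h6 : 0 ≤ δ * l * Real.log 2 := by positivity
  -- One `log 2` is lost to the ball bound and at most one to rounding `q / M` down; `hε` pays for
  -- both.
  have hmain : (Real.log q - Real.log M) * (1 - δ - ε) * l ≤ Real.log C.card := by
    nlinarith
  rw [codeRate, Real.logb, Real.logb, ← hq, le_div_iff₀ hl', le_div_iff₀ hlogq]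
  calc _ = (Real.log q - Real.log M) * (1 - δ - ε) * l := by field_simp
    _ ≤ _ := hmain

theorem exists_labelled_code_rate {δ ε : ℝ} (hδ0 : 0 < δ) (hδ1 : δ < 1) (hε0 : 0 < ε) :
    ∃ Q : ℕ, ∀ (M l d : ℕ) (A : Type*) [Fintype A] [DecidableEq A], 0 < M → 0 < l →
      (d : ℝ) ≤ δ * l → Q * M ≤ Fintype.card A →
      ∃ (C : Finset (Fin l → A)) (lab : A → ℕ), C.Nonempty ∧
        (∀ x ∈ C, ∀ i, lab (x i) = ((i : ℕ) + 1) % M) ∧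
        (∀ x ∈ C, ∀ y ∈ C, x ≠ y → d < hammingDist x y) ∧
        (1 - Real.logb (Fintype.card A) M) * (1 - δ - ε) ≤ codeRate C := by
  obtain ⟨Q, hQ⟩ := exists_nat_ge (Real.exp (2 * Real.log 2 / ε))
  -- `Q` forces `log (q / M) ≥ 2 log 2 / ε`; the extra 2 gives `q > 1` and a positive floor of `q /
  -- M`.
  refine ⟨Q + 2, fun M l d A _ _ hM hl hd hq => ?_⟩
  set q := Fintype.card A
  have hr2 : Q + 2 ≤ q / M := (Nat.le_div_iff_mul_le hM).2 hq
  have hr0 : 0 < q / M := by omega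
  obtain ⟨C, lab, hlab, hdist, hC⟩ :=
    exists_labelled_code (l := l) d hM hr0 (Nat.mul_div_le (Fintype.card A) M)
  have hq1 : 1 < q := by nlinarith
  refine ⟨C, lab, ?_, hlab, hdist, le_codeRate hδ1 hδ0 hl hM hd hr0 hq1 ?_ ?_ hC⟩
  · refine Finset.card_pos.1 (Nat.pos_of_ne_zero fun h => ?_)
    rw [h, zero_mul] at hC
    exact hC.not_gt (pow_pos hr0 l)
  · have h1 := Nat.lt_mul_div_succ q hM
    have h2 : q ≤ 2 * (M * (q / M)) := by nlinarith
    exact_mod_cast h2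
  · have hM' : (0 : ℝ) < M := by exact_mod_cast hM
    have hq' : (0 : ℝ) < q := by exact_mod_cast (by omega : 0 < q)
    rw [← Real.log_div hq'.ne' hM'.ne', ← div_le_iff₀' hε0,
      Real.le_log_iff_exp_le (by positivity), le_div_iff₀ hM']
    have h : ((Q + 2 : ℕ) : ℝ) * M ≤ q := by exact_mod_cast hq
    push_cast at h
    nlinarith

theorem mainTheorem10 (δ ε : ℝ) (hδ0 : 0 < δ) (hδ1 : δ < 1) (hε0 : 0 < ε) (hε1 : ε < 1) :
    ∃ Q : ℕ, ∀ (b q l t₁ : ℕ) (A : Type*) [Fintype A],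
      1 ≤ b → Fintype.card A = q → 1 ≤ l → (t₁ : ℝ) * b ≤ δ * l →
        (Q * (b + 1) ≤ q →
          ∃ C : Finset (Fin l → A), C.Nonempty ∧ IsBurstDeletionCorrecting b t₁ C ∧
            codeRate C ≥ (1 - Real.logb q (b + 1)) * (1 - δ - ε)) ∧
        (Q * (b + 2) ≤ q →
          ∃ C : Finset (Fin l → A), C.Nonempty ∧ IsBurstDeletionStickyCorrecting b t₁ C ∧
            codeRate C ≥ (1 - Real.logb q (b + 2)) * (1 - δ - ε)) := by
  classical
  obtain ⟨Q, hQ⟩ := exists_labelled_code_rate hδ0 hδ1 hε0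
  refine ⟨Q, fun b q l t₁ A _ _ hq hl ht => ?_⟩
  subst hq
  have hd : ((t₁ * b : ℕ) : ℝ) ≤ δ * l := by exact_mod_cast ht
  refine ⟨fun hb => ?_, fun hb => ?_⟩
  · obtain ⟨C, lab, hne, hlab, hdist, hrate⟩ := hQ (b + 1) l (t₁ * b) A (by omega) hl hd hb
    refine ⟨C, hne, fun x hx y hy m m' hm hm' hD hD' hread => ?_, by simpa using hrate⟩
    exact eq_of_readWord_eq (s := 1) le_rfl (by omega) (hlab x hx) (hlab y hy) hD hD'
      (Or.inr ⟨hm, hm'⟩) (hdist x hx y hy) hread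
  · obtain ⟨C, lab, hne, hlab, hdist, hrate⟩ := hQ (b + 2) l (t₁ * b) A (by omega) hl hd hb
    refine ⟨C, hne, fun x hx y hy m m' hD hD' hread => ?_, by simpa using hrate⟩
    exact eq_of_readWord_eq (s := 0) zero_le_one (by omega) (hlab x hx) (hlab y hy) hD hD'
      (Or.inl rfl) (hdist x hx y hy) hread
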